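/- Let $n, k, r$ be integers with $n \ge 1$, $0 \le k \le n$ and $r \ge 2$. Work with monomials $x_1^{a_1}\cdots x_n^{a_n}$ in $\mathbb{C}[x_1,\dots,x_n]$. For a subset $S=\{s_1<\cdots<s_m\}\subseteq\{1,\dots,n\}$, the skip monomial is $\mathbf{x}(S) := x_{s_1}^{s_1}x_{s_2}^{s_2-1}\cdots x_{s_m}^{s_m-m+1}$. Let $\mathcal{M}_{n,k}$ be the set of $(n,k)$-nonskip monomials, that is, of monomials $m$ such that $x_i^{kr+1}\nmid m$ for $1\le i\le n$ and $\mathbf{x}(S)^r\nmid m$ for all $S\subseteq\{1,\dots,n\}$ with $|S|=n-k+1$. Let $\mathcal{N}_{n,k}$ be the set of strongly $(n,k)$-nonskip monomials, that is, of those $m\in\mathcal{M}_{n,k}$ such that $x_i^{kr}\nmid m$ for $1\le i\le n$. A shuffle of two sequences $(a_1,\dots,a_p)$ and $(b_1,\dots,b_q)$ is an interleaving $(c_1,\dots,c_{p+q})$ of them that preserves the relative order of the $a$'s and of the $b$'s. Then $$\mathcal{M}_{n,k}=\left\{x_1^{a_1}\cdots x_n^{a_n} : (a_1,\dots,a_n)\text{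 is componentwise}\le\text{some shuffle of }(r-1,2r-1,\dots,kr-1)\text{ and }(\underbrace{kr,\dots,kr}_{n-k})\right\}$$ and $$\mathcal{N}_{n,k}=\left\{x_1^{a_1}\cdots x_n^{a_n} : (a_1,\dots,a_n)\text{ is componentwise}\le\text{some shuffle of }(r-1,2r-1,\dots,kr-1)\text{ and }(\underbrace{kr-1,\dots,kr-1}_{n-k})\right\}.$$ -/

import Mathlib

open MvPolynomial

noncomputable section

/-- The skip monomial `x(S) = x_{s₁}^{s₁} x_{s₂}^{s₂ - 1} ⋯ x_{s_m}^{s_m - m + 1}` of a set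
`S = {s₁ < ⋯ < s_m} ⊆ [n]`, as a polynomial in `ℂ[x₁, …, x_n]`. The variable `x_{i+1}` is `X i` for
`i : Fin n`. If `s_j = i + 1`, then `j - 1` is the number of elements of `S` below `i`, so
`s_j - j + 1 = (i + 1) - #{t ∈ S | t < i}`; this subtraction never truncates. -/
def skipMonomial {n : ℕ} (S : Finset (Fin n)) : MvPolynomial (Fin n) ℂ :=
  ∏ i ∈ S, X i ^ ((i : ℕ) + 1 - (S.filter (fun t => t < i)).card)

/-- `p` is a monomial `x₁^{a₁} ⋯ x_n^{a_n}` (with coefficient `1`). -/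
def IsMonomialPoly {n : ℕ} (p : MvPolynomial (Fin n) ℂ) : Prop :=
  ∃ a : Fin n →₀ ℕ, p = monomial a 1

/-- The set `M_{n,k}` of `(n,k)`-nonskip monomials in `ℂ[x₁, …, x_n]`
(used for `k ≤ n`, so that `n - k` is the true difference). -/
def nonskipMonomials (n k r : ℕ) : Set (MvPolynomial (Fin n) ℂ) :=
  {m | IsMonomialPoly m ∧ (∀ i : Fin n, ¬ X i ^ (k * r + 1) ∣ m) ∧
    ∀ S : Finset (Fin n), S.card = n - k + 1 → ¬ skipMonomial S ^ r ∣ m}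

/-- The set `N_{n,k}` of strongly `(n,k)`-nonskip monomials in `ℂ[x₁, …, x_n]`. -/
def stronglyNonskipMonomials (n k r : ℕ) : Set (MvPolynomial (Fin n) ℂ) :=
  {m | m ∈ nonskipMonomials n k r ∧ ∀ i : Fin n, ¬ X i ^ (k * r) ∣ m}

/-- `c` is a shuffle of the sequences `a` and `b`: the positions of `c` are partitioned into the
range of an increasing `f`, along which `c` reads `a`, and the range of an increasing `g`, along
which `c` reads `b`. -/
def IsShuffle {α : Type*} {p q n : ℕ} (a : Fin p → α) (b : Fin q → α) (c : Fin n → α) : Prop :=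
  ∃ (f : Fin p ↪o Fin n) (g : Fin q ↪o Fin n),
    IsCompl (Set.range f) (Set.range g) ∧ (∀ i, c (f i) = a i) ∧ (∀ j, c (g j) = b j)

/-- The sequence `(r - 1, 2r - 1, …, kr - 1)` of integers. -/
def staircase (k r : ℕ) : Fin k → ℤ := fun j => ((j : ℤ) + 1) * (r : ℤ) - 1

/-- The monomials `x₁^{a₁} ⋯ x_n^{a_n}` whose exponent sequence is componentwise `≤` some shuffle of
`(r - 1, 2r - 1, …, kr - 1)` and `(v, …, v)`, with `n - k` copies of `v`. -/
def belowShuffleMonomials (n k r : ℕ) (v : ℤ) : Set (MvPolynomial (Fin n) ℂ) :=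
  {m | ∃ a : Fin n →₀ ℕ, m = monomial a 1 ∧
    ∃ c : Fin n → ℤ, IsShuffle (staircase k r) (fun _ : Fin (n - k) => v) c ∧
      ∀ i, (a i : ℤ) ≤ c i}

end

/-!
Fix an exponent sequence `a` and let `s = (r - 1, 2r - 1, …)`. Call a set `F` of positions a
staircase set if writing `s` along `F` in increasing order bounds `a` there, and call `S` a skip set
if `x(S)^r` divides `x^a`. In terms of ranks, `i ∈ F` requires `aᵢ ≤ s_j` with `j` the number of
elements of `F` below `i`, while `i ∈ S` requires `aᵢ > s_j` with `j` the number of elements of `Sᶜ`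
below `i`. At the least common element of `F` and `S` these two requirements contradict each other,
so `F` and `S` are disjoint. If `F` is maximal, then its complement is a skip set: inserting `i` with
`aᵢ ≤ s_j` into `F` only raises the ranks of the other elements. Initial segments of staircase sets
and of skip sets are again such, so a staircase set of size `k` exists if and only if there is no
skip set of size `n - k + 1`.
-/

section MonomialDivisibility

variable {σ R : Type*} [CommSemiring R] [Nontrivial R]

theorem prod_X_pow_dvd_monomial_iff (S : Finset σ) (e : σ → ℕ) (a : σ →₀ ℕ) :
    (∏ i ∈ S, X i ^ e i) ∣ monomial a (1 : R) ↔ ∀ i ∈ S, e i ≤ a i := by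
  classical
  have hprod : (∏ i ∈ S, X i ^ e i) = monomial (∑ i ∈ S, Finsupp.single i (e i)) (1 : R) := by
    simp only [monomial_sum_one, X_pow_eq_monomial]
  rw [hprod, monomial_dvd_monomial]
  simp only [one_ne_zero, false_or, dvd_refl, and_true, Finsupp.le_def, Finsupp.finsetSum_apply,
    Finsupp.single_apply, Finset.sum_ite_eq']
  exact forall_congr' fun i => by split_ifs with hi <;> simp [hi]

theorem X_pow_dvd_monomial_iff (i : σ) (e : ℕ) (a : σ →₀ ℕ) :
    X i ^ e ∣ monomial a (1 : R) ↔ e ≤ a i := by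
  simpa using prod_X_pow_dvd_monomial_iff (R := R) {i} (fun _ => e) a

theorem forall_not_X_pow_dvd_monomial_iff (e : ℕ) (a : σ →₀ ℕ) :
    (∀ i, ¬ X i ^ e ∣ monomial a (1 : R)) ↔ ∀ i, (a i : ℤ) ≤ e - 1 := by
  simp only [X_pow_dvd_monomial_iff, not_le, Int.le_sub_one_iff, Nat.cast_lt]

end MonomialDivisibility

section InitialSubsets

open Finset

variable {α : Type*} [LinearOrder α]

theorem card_filter_lt_orderEmb {k : ℕ} (f : Fin k ↪o α) (j : Fin k) :
    #{t ∈ univ.map f.toEmbedding | t < f j} = j := by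
  simp [filter_map, filter_gt_eq_Iio]

theorem card_filter_lt_orderEmbOfFin {k : ℕ} (F : Finset α) (hF : #F = k) (j : Fin k) :
    #{t ∈ F | t < F.orderEmbOfFin hF j} = j := by
  simpa only [map_orderEmbOfFin_univ] using card_filter_lt_orderEmb (F.orderEmbOfFin hF) j

theorem exists_initial_subset_card_eq (T : Finset α) {m : ℕ} (hm : m ≤ #T) :
    ∃ S ⊆ T, #S = m ∧ ∀ i ∈ S, ∀ t ∈ T, t < i → t ∈ S := by
  rcases hm.eq_or_lt with rfl | hlt
  · exact ⟨T, Subset.rfl, rfl, fun _ _ t ht _ => ht⟩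
  · refine ⟨{t ∈ T | t < T.orderEmbOfFin rfl ⟨m, hlt⟩}, filter_subset _ _,
      card_filter_lt_orderEmbOfFin T rfl ⟨m, hlt⟩, fun i hi t ht hti => ?_⟩
    exact mem_filter.2 ⟨ht, hti.trans (mem_filter.1 hi).2⟩

end InitialSubsets

section StaircaseAndSkipSets

open Finset

variable {α β : Type*} [LinearOrder α]

/-- `F` is a set of positions along which `a` stays weakly below the sequence `s`: the positions
in `F` receive the terms `s 0, s 1, …` in increasing order. -/
def IsStaircaseSet [LE β] (s : ℕ → β) (a : α → β) (F : Finset α) : Prop :=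
  ∀ i ∈ F, a i ≤ s #{t ∈ F | t < i}

/-- `S` is a set of positions along which `a` exceeds the sequence `s` at the number of earlier
positions outside `S`. For `s j = (j + 1) * r - 1` this says that `x(S)^r` divides `x^a`. -/
def IsSkipSet [Fintype α] [LT β] (s : ℕ → β) (a : α → β) (S : Finset α) : Prop :=
  ∀ i ∈ S, s #{t ∈ Sᶜ | t < i} < a i

variable [Preorder β] {s : ℕ → β} {a : α → β}

theorem IsStaircaseSet.of_initial {F T : Finset α} (hs : Monotone s) (hF : IsStaircaseSet s a F)
    (hTF : T ⊆ F) (hT : ∀ i ∈ T, ∀ t ∈ F, t < i → t ∈ T) : IsStaircaseSet s a T := by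
  intro i hi
  refine (hF i (hTF hi)).trans (hs (card_le_card fun t ht => ?_))
  obtain ⟨htF, hti⟩ := mem_filter.1 ht
  exact mem_filter.2 ⟨hT i hi t htF hti, hti⟩

protected theorem IsStaircaseSet.insert {F : Finset α} (hs : Monotone s) (hF : IsStaircaseSet s a F)
    {i : α} (hi : a i ≤ s #{t ∈ F | t < i}) : IsStaircaseSet s a (insert i F) := by
  have hmono (j : α) : s #{t ∈ F | t < j} ≤ s #{t ∈ insert i F | t < j} :=
    hs (card_le_card (filter_subset_filter _ (subset_insert i F)))
  intro j hj
  obtain rfl | hjF := mem_insert.1 hj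
  · exact hi.trans (hmono j)
  · exact (hF j hjF).trans (hmono j)

theorem IsStaircaseSet.le_of_forall_lt_card {F : Finset α} {v : β} (hF : IsStaircaseSet s a F)
    (hv : ∀ j < #F, s j ≤ v) {i : α} (hi : i ∈ F) : a i ≤ v :=
  (hF i hi).trans (hv _ (card_lt_card (filter_ssubset.2 ⟨i, hi, lt_irrefl i⟩)))

variable [Fintype α]

theorem IsSkipSet.of_initial {S T : Finset α} (hs : Monotone s) (hS : IsSkipSet s a S)
    (hTS : T ⊆ S) (hT : ∀ i ∈ T, ∀ t ∈ S, t < i → t ∈ T) : IsSkipSet s a T := by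
  intro i hi
  refine (hs (card_le_card fun t ht => ?_)).trans_lt (hS i (hTS hi))
  obtain ⟨htT, hti⟩ := mem_filter.1 ht
  exact mem_filter.2 ⟨mem_compl.2 fun htS => mem_compl.1 htT (hT i hi t htS hti), hti⟩

theorem IsStaircaseSet.disjoint_isSkipSet {F S : Finset α} (hs : Monotone s)
    (hF : IsStaircaseSet s a F) (hS : IsSkipSet s a S) : Disjoint F S := by
  rw [disjoint_iff_inter_eq_empty, ← not_nonempty_iff_eq_empty]
  intro hne
  set i := (F ∩ S).min' hne
  have hi := mem_inter.1 (min'_mem _ hne)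
  have hsub : {t ∈ F | t < i} ⊆ {t ∈ Sᶜ | t < i} := by
    intro t ht
    obtain ⟨htF, hti⟩ := mem_filter.1 ht
    refine mem_filter.2 ⟨mem_compl.2 fun htS => ?_, hti⟩
    exact hti.not_ge (min'_le _ _ (mem_inter.2 ⟨htF, htS⟩))
  exact ((hF i hi.1).trans (hs (card_le_card hsub))).not_gt (hS i hi.2)

end StaircaseAndSkipSets

section Duality

open Finset

variable {α β : Type*} [LinearOrder α] [Fintype α] [LinearOrder β] {s : ℕ → β}

theorem exists_isStaircaseSet_isSkipSet_compl (hs : Monotone s) (a : α → β) :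
    ∃ F : Finset α, IsStaircaseSet s a F ∧ IsSkipSet s a Fᶜ := by
  obtain ⟨F, hF⟩ := (Set.toFinite {F : Finset α | IsStaircaseSet s a F}).exists_maximal
    ⟨∅, fun i hi => absurd hi (notMem_empty i)⟩
  refine ⟨F, hF.prop, fun i hi => ?_⟩
  rw [compl_compl]
  by_contra! hle
  exact mem_compl.1 hi (hF.le_of_ge (hF.prop.insert hs hle) (subset_insert i F)
    (mem_insert_self i F))

theorem exists_isStaircaseSet_card_eq_iff (hs : Monotone s) {a : α → β} {p q : ℕ}
    (hpq : p + q = Fintype.card α) :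
    (∃ F : Finset α, #F = p ∧ IsStaircaseSet s a F) ↔
      ∀ S : Finset α, #S = q + 1 → ¬ IsSkipSet s a S := by
  constructor
  · rintro ⟨F, hFp, hF⟩ S hSq hS
    have hle := card_le_univ (F ∪ S)
    rw [card_union_of_disjoint (hF.disjoint_isSkipSet hs hS)] at hle
    lia
  · intro hskip
    obtain ⟨F, hF, hFc⟩ := exists_isStaircaseSet_isSkipSet_compl hs a
    have hpF : p ≤ #F := by
      by_contra! hlt
      obtain ⟨S, hSF, hSq, hS⟩ := exists_initial_subset_card_eq Fᶜ (m := q + 1) (by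
        rw [card_compl]
        lia)
      exact hskip S hSq (hFc.of_initial hs hSF hS)
    obtain ⟨T, hTF, hTp, hT⟩ := exists_initial_subset_card_eq F hpF
    exact ⟨T, hTp, hF.of_initial hs hTF hT⟩

end Duality

section Shuffles

open Finset

variable {β : Type*} {n p q : ℕ} {s : ℕ → β} {v : β} {a : Fin n → β}

theorem exists_isShuffle_const_le_iff_exists_finset [LE β] (hpq : p + q = n) :
    (∃ c : Fin n → β, IsShuffle (fun j : Fin p => s j) (fun _ : Fin q => v) c ∧ ∀ i, a i ≤ c i) ↔
      ∃ F : Finset (Fin n), #F = p ∧ IsStaircaseSet s a F ∧ ∀ i ∉ F, a i ≤ v := by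
  constructor
  · rintro ⟨c, ⟨f, g, hfg, hf, hg⟩, hac⟩
    refine ⟨univ.map f.toEmbedding, by simp, fun i hi => ?_, fun i hi => ?_⟩
    · obtain ⟨j, -, rfl⟩ := mem_map.1 hi
      exact (hac (f j)).trans_eq ((hf j).trans (congrArg s (card_filter_lt_orderEmb f j).symm))
    · have hig : i ∈ Set.range g := by
        rw [← hfg.compl_eq]
        simpa using hi
      obtain ⟨j, rfl⟩ := hig
      exact (hac (g j)).trans_eq (hg j)
  · rintro ⟨F, hF, hle, hv⟩
    have hFc : #Fᶜ = q := by
      rw [card_compl, Fintype.card_fin]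
      lia
    refine ⟨fun i => if i ∈ F then s #{t ∈ F | t < i} else v,
      ⟨F.orderEmbOfFin hF, Fᶜ.orderEmbOfFin hFc, ?_, fun j => ?_, fun j => ?_⟩, fun i => ?_⟩
    · simpa only [range_orderEmbOfFin, coe_compl] using isCompl_compl
    · simp only [orderEmbOfFin_mem, if_true, card_filter_lt_orderEmbOfFin]
    · exact if_neg (mem_compl.1 (orderEmbOfFin_mem _ _ _))
    · dsimp only
      split_ifs with hi
      exacts [hle i hi, hv i hi]

theorem exists_isShuffle_const_le_iff [LinearOrder β] (hs : Monotone s) (hpq : p + q = n)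
    (hv : ∀ j < p, s j ≤ v) :
    (∃ c : Fin n → β, IsShuffle (fun j : Fin p => s j) (fun _ : Fin q => v) c ∧ ∀ i, a i ≤ c i) ↔
      (∀ i, a i ≤ v) ∧ ∀ S : Finset (Fin n), #S = q + 1 → ¬ IsSkipSet s a S := by
  rw [exists_isShuffle_const_le_iff_exists_finset hpq,
    ← exists_isStaircaseSet_card_eq_iff hs (hpq.trans (Fintype.card_fin n).symm)]
  constructor
  · rintro ⟨F, rfl, hF, hFv⟩
    refine ⟨fun i => ?_, F, rfl, hF⟩
    by_cases hi : i ∈ F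
    exacts [hF.le_of_forall_lt_card hv hi, hFv i hi]
  · rintro ⟨hav, F, hFp, hF⟩
    exact ⟨F, hFp, hF, fun i _ => hav i⟩

end Shuffles

section NonskipMonomials

open Finset

/-- The infinite sequence `r - 1, 2r - 1, 3r - 1, …`, whose first `k` terms are `staircase k r`. -/
def staircaseStep (r j : ℕ) : ℤ := ((j : ℤ) + 1) * r - 1

theorem monotone_staircaseStep (r : ℕ) : Monotone (staircaseStep r) := by
  intro i j hij
  unfold staircaseStep
  gcongr

/-- The monomials `x^a` with `aᵢ ≤ v` for all `i` which are divisible by no `x(S)^r` with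
`|S| = n - k + 1`. The values `v = kr` and `v = kr - 1` give `M_{n,k}` and `N_{n,k}`. -/
def boundedNonskipMonomials (n k r : ℕ) (v : ℤ) : Set (MvPolynomial (Fin n) ℂ) :=
  {m | ∃ a : Fin n →₀ ℕ, m = monomial a 1 ∧ (∀ i, (a i : ℤ) ≤ v) ∧
    ∀ S : Finset (Fin n), #S = n - k + 1 → ¬ skipMonomial S ^ r ∣ m}

variable {n k r : ℕ}

theorem val_add_one_sub_card_filter_lt (S : Finset (Fin n)) (i : Fin n) :
    (i : ℕ) + 1 - #{t ∈ S | t < i} = #{t ∈ Sᶜ | t < i} + 1 := by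
  have hcard : #{t ∈ S | t < i} + #{t ∈ Sᶜ | t < i} = i := by
    rw [← card_union_of_disjoint (disjoint_filter_filter disjoint_compl_right),
      ← filter_union, union_compl, filter_gt_eq_Iio, Fin.card_Iio]
  lia

theorem skipMonomial_pow_dvd_monomial_iff (S : Finset (Fin n)) (a : Fin n →₀ ℕ) :
    skipMonomial S ^ r ∣ monomial a 1 ↔ IsSkipSet (staircaseStep r) (fun i => (a i : ℤ)) S := by
  simp only [skipMonomial, val_add_one_sub_card_filter_lt, ← prod_pow, ← pow_mul,
    prod_X_pow_dvd_monomial_iff, IsSkipSet, staircaseStep, Int.sub_one_lt_iff]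
  norm_cast

theorem nonskipMonomials_eq_boundedNonskipMonomials :
    nonskipMonomials n k r = boundedNonskipMonomials n k r (k * r) := by
  have hbound (a : Fin n →₀ ℕ) :
      (∀ i, ¬ X i ^ (k * r + 1) ∣ monomial a (1 : ℂ)) ↔ ∀ i, (a i : ℤ) ≤ k * r := by
    simpa using forall_not_X_pow_dvd_monomial_iff (R := ℂ) (k * r + 1) a
  ext m
  constructor
  · rintro ⟨⟨a, rfl⟩, hX, hS⟩
    exact ⟨a, rfl, (hbound a).1 hX, hS⟩
  · rintro ⟨a, rfl, ha, hS⟩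
    exact ⟨⟨a, rfl⟩, (hbound a).2 ha, hS⟩

theorem stronglyNonskipMonomials_eq_boundedNonskipMonomials :
    stronglyNonskipMonomials n k r = boundedNonskipMonomials n k r (k * r - 1) := by
  have hbound (a : Fin n →₀ ℕ) :
      (∀ i, ¬ X i ^ (k * r) ∣ monomial a (1 : ℂ)) ↔ ∀ i, (a i : ℤ) ≤ k * r - 1 := by
    simpa using forall_not_X_pow_dvd_monomial_iff (R := ℂ) (k * r) a
  ext m
  constructor
  · rintro ⟨⟨⟨a, rfl⟩, -, hS⟩, hX⟩
    exact ⟨a, rfl, (hbound a).1 hX, hS⟩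
  · rintro ⟨a, rfl, ha, hS⟩
    have hX := (hbound a).2 ha
    exact ⟨⟨⟨a, rfl⟩, fun i hi => hX i ((pow_dvd_pow _ (Nat.le_succ _)).trans hi), hS⟩, hX⟩

theorem belowShuffleMonomials_eq_boundedNonskipMonomials (hk : k ≤ n) {v : ℤ}
    (hv : (k : ℤ) * r - 1 ≤ v) :
    belowShuffleMonomials n k r v = boundedNonskipMonomials n k r v := by
  have hstep (j : ℕ) (hj : j < k) : staircaseStep r j ≤ v := by
    refine le_trans ?_ hv
    unfold staircaseStep
    gcongr
    exact_mod_cast hj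
  ext m
  refine exists_congr fun a => and_congr_right ?_
  rintro rfl
  simp only [skipMonomial_pow_dvd_monomial_iff]
  exact exists_isShuffle_const_le_iff (monotone_staircaseStep r) (Nat.add_sub_of_le hk) hstep

end NonskipMonomials

theorem mainTheorem4_general (n k r : ℕ) (hk : k ≤ n) :
    nonskipMonomials n k r = belowShuffleMonomials n k r ((k : ℤ) * (r : ℤ)) ∧
    stronglyNonskipMonomials n k r =
      belowShuffleMonomials n k r ((k : ℤ) * (r : ℤ) - 1) := by
  rw [belowShuffleMonomials_eq_boundedNonskipMonomials hk (by lia),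
    belowShuffleMonomials_eq_boundedNonskipMonomials hk le_rfl]
  exact ⟨nonskipMonomials_eq_boundedNonskipMonomials,
    stronglyNonskipMonomials_eq_boundedNonskipMonomials⟩

theorem mainTheorem4 (n k r : ℕ) (hn : 1 ≤ n) (hk : k ≤ n) (hr : 2 ≤ r) :
    nonskipMonomials n k r = belowShuffleMonomials n k r ((k : ℤ) * (r : ℤ)) ∧
    stronglyNonskipMonomials n k r =
      belowShuffleMonomials n k r ((k : ℤ) * (r : ℤ) - 1) :=
  mainTheorem4_general n k r hk
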